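/- Let $n$ and $r$ be integers with $1\le r\le n$. Let $\mathsf T_n$ be the set of labeled trees on the vertex set $\{0,1,\dots,n\}$, rooted at $0$. For $T\in\mathsf T_n$, run depth-first search on $T$ starting at $0$: from the current vertex it moves to the unvisited neighbor of highest label if there is an unvisited neighbor, and otherwise it backtracks. Let $\operatorname{leg}(T)$ be the number of vertices different from the root that are visited before the search backtracks for the first time (so $\operatorname{leg}(T)=n$ if $T$ is a path with endpoint $0$), and let $$\mathrm{LT}_n(t)=\sum_{T\in\mathsf T_n}t^{\operatorname{leg}(T)} .$$ Then the coefficient of $t^r$ in $\mathrm{LT}_n(t)$, that is, the number of trees $T\in\mathsf T_n$ with $\operatorname{leg}(T)=r$, satisfies $$[t^r]\,\mathrm{LT}_n(t)=r!\sum_{e_1+\dots+e_r=n-r}(n-1)^{e_1}(n-2)^{e_2}\cdots(n-r)^{e_r} = r\sum_{j=0}^{r-1}(-1)^j\binom{r-1}{j}(n-1-j)^{n-1},$$ where the first sum is over all $r$-tuples $(e_1,\dots,e_r)$ of non-negative integers with sum $n-r$, and $0^0=1$. -/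

import Mathlib

namespace DFSLeg

/-- A move of the depth-first search: either an unvisited vertex is visited, or the search
backtracks from the current vertex. -/
inductive Move (V : Type*) where
  | visit (v : V) : Move V
  | backtrack : Move V

/-- Whether a move is a visit (and not a backtrack). -/
def Move.isVisit {V : Type*} : Move V → Bool
  | .visit _ => true
  | .backtrack => false

/-- A state of the depth-first search: the stack of active vertices (its head is the current
vertex) and the set of vertices visited so far. -/
structure State (V : Type*) where
  stack : List V
  visited : Finset V

section
variable {V : Type*} [Fintype V] [LinearOrder V] (G : SimpleGraph V) [DecidableRel G.Adj]

/-- The neighbors of `u` in `G` that do not belong to the set `S` of visited vertices. -/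
def unvisitedNeighbors (S : Finset V) (u : V) : Finset V :=
  Finset.univ.filter fun v => G.Adj u v ∧ v ∉ S

/-- One step of the depth-first search: from the current vertex `u`, visit the unvisited neighbor
of highest label if there is an unvisited neighbor, and backtrack otherwise. The search is over
(`none`) when the stack is empty. -/
def step (s : State V) : Option (Move V × State V) :=
  match s.stack with
  | [] => none
  | u :: rest =>
    if h : (unvisitedNeighbors G s.visited u).Nonempty then
      let v := (unvisitedNeighbors G s.visited u).max' h
      some (.visit v, ⟨v :: u :: rest, insert v s.visited⟩)
    else
      some (.backtrack, ⟨rest, s.visited⟩)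

/-- The sequence of (at most) the first `k` moves of the depth-first search from the state `s`. -/
def moves : ℕ → State V → List (Move V)
  | 0, _ => []
  | k + 1, s =>
    match step G s with
    | none => []
    | some (m, s') => m :: moves k s'

/-- The complete sequence of moves of the depth-first search started at the vertex `root`.
Every vertex enters the stack at most once and leaves it at most once, so the search ends
within `2 * |V|` moves. -/
def dfs (root : V) : List (Move V) :=
  moves G (2 * Fintype.card V) ⟨[root], {root}⟩

/-- The number of vertices different from `root` that the depth-first search started at `root`
visits before it backtracks for the first time. (The root itself is visited at the start and is
not the object of a move.) -/
def leg (root : V) : ℕ :=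
  ((dfs G root).takeWhile Move.isVisit).length

end

open Classical in
/-- The enumerator `∑ t ^ leg T`, over the trees `T` on the vertex set `{0, 1, …, n}`,
rooted at `0`. -/
noncomputable def LT (n : ℕ) : Polynomial ℤ :=
  ∑ T : SimpleGraph (Fin (n + 1)) with T.IsTree, Polynomial.X ^ leg T 0

end DFSLeg

/-!
A tree rooted at `ρ` is the same thing as its parent map `p` (`IsParentMap`), and its leg is the
length of its *descent*: the list of vertices met when moving from the root, again and again, to the
child of highest label, until a vertex without children is reached (`leg_parentGraph`).

Fix the descent `l` and let `S` be its set of vertices. That `l` is the descent of `p` restricts each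
value `p w` separately: for `w` in `S` it is the predecessor in `l`, and for `w` in the
complement `W` of `S ∪ {ρ}` it is any vertex of `W`, or the predecessor of some `s ∈ S` with `w < s`.
So parent maps with descent `l` are forests on `W` in which `w` can be a root in
`c w = #{s ∈ S | w < s}` ways. By `card_escaping`, a version of Cayley's formula, their number is
`∏ w ∈ W, (x + c w)` minus its derivative in `x`, at `x = #W`.

There are `r!` descents for each `r`-set `S`. The sum of `∏ w ∈ W, (X + c w)` over all `S` is, by
induction on the least label, the complete homogeneous polynomial `h` of degree `n - r` in
`X, …, X + r` (`sum_powersetCard_prod_sdiff`). These polynomials form an Appell sequence for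
fixed `r`, so that at `X = n - r` the difference of `h` and its derivative is the complete
homogeneous polynomial of degree `n - r` in `n - r, …, n - 1`
(`sum_powersetCard_prod_sub_sum_prod`). This is the first formula. The second one holds because
complete homogeneous polynomials of consecutive integers are finite differences of powers
(`factorial_mul_eval_shiftedComplete`).
-/

namespace DFSLeg

open Finset

section Algebra

open Polynomial

/-! ### Complete homogeneous polynomials of consecutive integers -/

/-- The complete homogeneous polynomial of degree `n - r` in the `r + 1` quantities
`X, X + 1, …, X + r`, as a polynomial in `X` (zero for `n < r`), defined by the recursion that
decides whether a monomial contains the last of these quantities. -/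
noncomputable def shiftedComplete : ℕ → ℕ → ℤ[X]
  | 0, 0 => 1
  | 0, _ + 1 => 0
  | n + 1, 0 => X * shiftedComplete n 0
  | n + 1, r + 1 => shiftedComplete n r + (X + (r + 1 : ℤ[X])) * shiftedComplete n (r + 1)

theorem shiftedComplete_of_lt {n r : ℕ} (h : n < r) : shiftedComplete n r = 0 := by
  induction n generalizing r with
  | zero => obtain ⟨r, rfl⟩ := Nat.exists_eq_add_of_lt h; simp [shiftedComplete]
  | succ n ih =>
    cases r with
    | zero => omega
    | succ r => rw [shiftedComplete, ih (by omega), ih (by omega)]; simp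

/-- For fixed `r` these polynomials form an Appell sequence. -/
theorem derivative_shiftedComplete (n r : ℕ) :
    derivative (shiftedComplete (n + 1) r) = (n + 1 : ℤ[X]) * shiftedComplete n r := by
  induction n generalizing r with
  | zero =>
    rcases r with _ | _ | r <;> simp [shiftedComplete]
  | succ n ih =>
    cases r with
    | zero =>
      rw [shiftedComplete, derivative_mul, ih, derivative_X, shiftedComplete]
      push_cast; ring
    | succ r =>
      rw [shiftedComplete, derivative_add, derivative_mul, ih, ih, shiftedComplete]
      simp only [derivative_add, derivative_X, derivative_natCast, derivative_one]
      push_cast; ring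

/-- Summing over the `r`-subsets `S` of `A`, where an element `w` outside `S` has the weight
`X + #{s ∈ S | w < s}`. The recursion decides whether the least element of `A` lies in `S`. -/
theorem sum_powersetCard_prod_sdiff {α : Type*} [LinearOrder α] (A : Finset α) (r : ℕ) :
    ∑ S ∈ A.powersetCard r, ∏ w ∈ A \ S, (X + C (#{s ∈ S | w < s} : ℤ)) =
      shiftedComplete #A r := by
  induction A using Finset.induction_on_min generalizing r with
  | empty =>
    cases r with
    | zero => simp [shiftedComplete]
    | succ r => simp [shiftedComplete]
  | insert a A ha ih =>
    have haA : a ∉ A := fun h => lt_irrefl _ (ha a h)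
    have key : ∀ S ⊆ A, ∏ w ∈ insert a A \ S, (X + C (#{s ∈ S | w < s} : ℤ)) =
        (X + C (#S : ℤ)) * ∏ w ∈ A \ S, (X + C (#{s ∈ S | w < s} : ℤ)) := by
      intro S hS
      rw [insert_sdiff_of_notMem _ (fun h => haA (hS h)), prod_insert (by simp [haA]),
        filter_true_of_mem (fun s hs => ha s (hS hs))]
    rw [card_insert_of_notMem haA]
    cases r with
    | zero =>
      have := ih 0
      simp only [powersetCard_zero, sum_singleton] at this ⊢
      rw [key ∅ (empty_subset _), this, shiftedComplete]; simp
    | succ r =>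
      rw [powersetCard_succ_insert haA, sum_union, sum_image, shiftedComplete, ← ih r,
        ← ih (r + 1), add_comm, mul_sum]
      · congr 1
        · refine sum_congr rfl fun S hS => ?_
          rw [insert_sdiff_insert]
          have : A \ insert a S = A \ S := by
            ext x; simp only [mem_sdiff, mem_insert]; constructor
            · tauto
            · rintro ⟨h1, h2⟩
              exact ⟨h1, by rintro (rfl | h); exacts [haA h1, h2 h]⟩
          rw [this]
          refine prod_congr rfl fun w hw => ?_
          rw [filter_insert, if_neg (ha w (mem_sdiff.1 hw).1).le.not_gt]
        · refine sum_congr rfl fun S hS => ?_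
          rw [mem_powersetCard] at hS
          rw [key S hS.1, hS.2]; simp
      · intro S hS T hT h
        have hS' : a ∉ S := fun h => haA ((mem_powersetCard.1 hS).1 h)
        have hT' : a ∉ T := fun h => haA ((mem_powersetCard.1 hT).1 h)
        rw [← erase_insert hS', ← erase_insert hT', h]
      · rw [disjoint_left]
        intro S hS hS'
        obtain ⟨T, -, rfl⟩ := mem_image.1 hS'
        exact haA ((mem_powersetCard.1 hS).1 (mem_insert_self _ _))

/-- By `sum_powersetCard_prod_sdiff` the sum is `P - P'` at `m`, where `P = shiftedComplete n (r + 1)`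
and `n = m + r + 1`. Here `P' = n * shiftedComplete (n - 1) (r + 1)`, and this cancels against the
second term of the recursion for `P`, whose coefficient `X + (r + 1)` is `n` at `X = m`. -/
theorem sum_powersetCard_prod_sub_sum_prod {α : Type*} [LinearOrder α] (A : Finset α)
    {r m : ℕ} (h : #A = m + (r + 1)) :
    ∑ S ∈ A.powersetCard (r + 1),
      (∏ w ∈ A \ S, ((m : ℤ) + #{s ∈ S | w < s}) -
        ∑ a ∈ A \ S, ∏ w ∈ (A \ S).erase a, ((m : ℤ) + #{s ∈ S | w < s})) =
      (shiftedComplete (m + r) r).eval (m : ℤ) := by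
  have h1 := sum_powersetCard_prod_sdiff A (r + 1)
  have h2 := congrArg (fun P : ℤ[X] => (P - derivative P).eval (m : ℤ)) h1
  simp only [eval_sub, derivative_sum, eval_finsetSum, derivative_prod_finset, eval_prod,
    eval_add, eval_X, eval_C, derivative_add, derivative_X, derivative_C, add_zero,
    mul_one] at h2
  rw [sum_sub_distrib, h2, h, ← add_assoc, derivative_shiftedComplete, shiftedComplete]
  simp; ring

theorem sum_antidiagonalTuple_succ {R : Type*} [CommSemiring R] (r k : ℕ)
    (F : (Fin (r + 1) → ℕ) → R) :
    ∑ e ∈ Finset.Nat.antidiagonalTuple (r + 1) k, F e =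
      ∑ a ∈ antidiagonal k, ∑ e ∈ Finset.Nat.antidiagonalTuple r a.2, F (Fin.cons a.1 e) := by
  rw [sum_sigma']
  refine sum_bij' (fun e _ => ⟨(e 0, ∑ i, Fin.tail e i), Fin.tail e⟩)
    (fun x _ => Fin.cons x.1.1 x.2) ?_ ?_ ?_ ?_ ?_
  · intro e he
    rw [Finset.Nat.mem_antidiagonalTuple, Fin.sum_univ_succ] at he
    simp [Finset.Nat.mem_antidiagonalTuple, Fin.tail, he]
  · rintro ⟨⟨a, b⟩, e⟩ he
    simp only [mem_sigma, HasAntidiagonal.mem_antidiagonal, Finset.Nat.mem_antidiagonalTuple] at he ⊢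
    simp [Fin.sum_univ_succ, he]
  · intro e _; simp
  · rintro ⟨⟨a, b⟩, e⟩ he
    simp only [mem_sigma, HasAntidiagonal.mem_antidiagonal, Finset.Nat.mem_antidiagonalTuple] at he
    obtain ⟨_, rfl⟩ := he
    simp
  · intro e _; simp

/-- The complete homogeneous polynomial of degree `k` in `y, y - 1, …, y - r + 1`. -/
def completeSum (r k : ℕ) (y : ℤ) : ℤ :=
  ∑ e ∈ Finset.Nat.antidiagonalTuple r k, ∏ i : Fin r, (y - (i : ℕ)) ^ e i

theorem completeSum_succ (r k : ℕ) (y : ℤ) :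
    completeSum (r + 1) k y = ∑ a ∈ antidiagonal k, y ^ a.1 * completeSum r a.2 (y - 1) := by
  rw [completeSum, sum_antidiagonalTuple_succ]
  refine sum_congr rfl fun a _ => ?_
  rw [completeSum, mul_sum]
  refine sum_congr rfl fun e _ => ?_
  rw [Fin.prod_univ_succ]
  simp [sub_sub, add_comm]

theorem completeSum_succ_succ (r k : ℕ) (y : ℤ) :
    completeSum (r + 1) (k + 1) y =
      completeSum r (k + 1) (y - 1) + y * completeSum (r + 1) k y := by
  rw [completeSum_succ, Finset.Nat.sum_antidiagonal_succ, completeSum_succ r k, mul_sum]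
  simp [pow_succ', mul_assoc]

theorem completeSum_zero_right (r : ℕ) (y : ℤ) : completeSum r 0 y = 1 := by
  simp [completeSum, Finset.Nat.antidiagonalTuple_zero_right]

theorem shiftedComplete_self (r : ℕ) : shiftedComplete r r = 1 := by
  induction r with
  | zero => rfl
  | succ r ih => rw [shiftedComplete, ih, shiftedComplete_of_lt (Nat.lt_succ_self r)]; simp

theorem eval_shiftedComplete (k r : ℕ) (x : ℤ) :
    (shiftedComplete (k + r) r).eval x = completeSum (r + 1) k (x + r) := by
  induction r generalizing k with
  | zero =>
    have h : ∀ n, (shiftedComplete n 0) = X ^ n := by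
      intro n
      induction n with
      | zero => rfl
      | succ n ih => rw [shiftedComplete, ih, pow_succ']
    simp [h, completeSum]
  | succ r ihr =>
    induction k with
    | zero => rw [zero_add, shiftedComplete_self, completeSum_zero_right, eval_one]
    | succ k ihk =>
      rw [completeSum_succ_succ, ← ihk]
      have := ihr (k + 1)
      rw [show x + ((r + 1 : ℕ) : ℤ) - 1 = x + r by push_cast; ring, ← this,
        show k + 1 + (r + 1) = (k + (r + 1)) + 1 by ring, shiftedComplete,
        show k + 1 + r = k + (r + 1) by ring]
      simp

/-- Up to the factor `r!`, these polynomials are the iterated finite differences of the powers. -/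
theorem factorial_mul_eval_shiftedComplete (n r : ℕ) (x : ℤ) :
    (r.factorial : ℤ) * (shiftedComplete n r).eval x =
      ∑ j ∈ range (r + 1), (-1) ^ j * (r.choose j : ℤ) * (x + r - j) ^ n := by
  induction n generalizing r with
  | zero =>
    simp only [pow_zero, mul_one]
    rw [Int.alternating_sum_range_choose]
    cases r <;> simp [shiftedComplete]
  | succ n ih =>
    cases r with
    | zero =>
      have := ih 0
      simp at this
      simp [shiftedComplete, this, pow_succ']
    | succ r =>
      have hsplit : ∀ j : ℕ, (-1 : ℤ) ^ j * ((r + 1).choose j : ℤ) *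
          (x + ((r + 1 : ℕ) : ℤ) - j) ^ (n + 1) =
          (x + r + 1) * ((-1 : ℤ) ^ j * ((r + 1).choose j : ℤ) *
          (x + ((r + 1 : ℕ) : ℤ) - j) ^ n) -
          (-1 : ℤ) ^ j * ((j : ℤ) * ((r + 1).choose j : ℤ)) *
          (x + ((r + 1 : ℕ) : ℤ) - j) ^ n := by
        intro j; push_cast; ring
      rw [sum_congr rfl fun j _ => hsplit j, sum_sub_distrib, ← mul_sum, ← ih (r + 1),
        sum_range_succ' _ (r + 1)]
      have habs : ∀ j : ℕ, (-1 : ℤ) ^ (j + 1) * (((j + 1 : ℕ) : ℤ) *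
          ((r + 1).choose (j + 1) : ℤ)) * (x + ((r + 1 : ℕ) : ℤ) - ((j + 1 : ℕ) : ℤ)) ^ n =
          -((r + 1 : ℤ) * ((-1) ^ j * (r.choose j : ℤ) * (x + r - j) ^ n)) := by
        intro j
        have h : ((j + 1 : ℕ) : ℤ) * ((r + 1).choose (j + 1) : ℤ) = (r + 1) * r.choose j := by
          have := Nat.add_one_mul_choose_eq r j
          rw [mul_comm]; exact_mod_cast this.symm
        rw [h, pow_succ]; push_cast; ring
      rw [sum_congr rfl fun j _ => habs j, sum_neg_distrib, ← mul_sum, ← ih r, shiftedComplete,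
        Nat.factorial_succ]
      simp; ring

end Algebra

/-! ### Counting forests with prescribed parent sets -/

open Polynomial in
theorem sum_powerset_prod_mul {α : Type*} [DecidableEq α] (W : Finset α) (c : α → ℤ) (x : ℤ) :
    ∑ R ∈ W.powerset, (∏ w ∈ R, c w) *
        (x ^ #(W \ R) - #(W \ R) * x ^ (#(W \ R) - 1)) =
      ∏ w ∈ W, (c w + x) - ∑ a ∈ W, ∏ w ∈ W.erase a, (c w + x) := by
  -- Apply `P ↦ P(x) - P'(x)` to the expansion of the product `P = ∏ w ∈ W, (c w + X)`.
  have h := prod_add (fun w => C (c w)) (fun _ => (X : ℤ[X])) W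
  have h2 := congrArg (fun P : ℤ[X] => (P - derivative P).eval x) h
  simp only [eval_sub, derivative_sum, eval_finsetSum, derivative_prod_finset, eval_prod,
    eval_add, eval_mul, eval_X, eval_C, derivative_add, derivative_X, derivative_C, zero_add,
    mul_one, prod_const, ← map_prod, derivative_C_mul, derivative_X_pow,
    eval_pow] at h2
  rw [h2, ← sum_sub_distrib]
  refine sum_congr rfl fun R _ => ?_
  ring

open scoped Classical in
/-- A map all of whose orbits leave `W` is a forest on `W`, whose roots are the points of `W` that
are mapped out of `W`. If `D v` is the set of permitted values at `v`, and every point of `W` may be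
mapped to every point of `W`, then the number of such maps depends on the cardinalities of
the sets `D v` only. The induction removes from `W` the set `R` of roots. -/
theorem card_escaping {V : Type*} [Fintype V] [DecidableEq V] (W : Finset V)
    (D : V → Finset V) (hD : ∀ w ∈ W, W ⊆ D w) :
    (#{p ∈ Fintype.piFinset D | ∀ v, ∃ k, p^[k] v ∉ W} : ℤ) =
      (∏ v ∈ Wᶜ, (#(D v) : ℤ)) *
        (∏ w ∈ W, (#(D w) : ℤ) - ∑ a ∈ W, ∏ w ∈ W.erase a, (#(D w) : ℤ)) := by
  induction W using Finset.strongInduction generalizing D with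
  | H W ih =>
  rcases W.eq_empty_or_nonempty with rfl | hW
  · simp [Fintype.card_piFinset]
  have hmaps : ∀ p ∈ {p ∈ Fintype.piFinset D | ∀ v, ∃ k, p^[k] v ∉ W},
      {w ∈ W | p w ∉ W} ∈ W.powerset := fun p _ => mem_powerset.2 (filter_subset _ _)
  have hfib : ∀ R ∈ W.powerset,
      (#{p ∈ {p ∈ Fintype.piFinset D | ∀ v, ∃ k, p^[k] v ∉ W} | {w ∈ W | p w ∉ W} = R} : ℤ) =
        (∏ v ∈ Wᶜ, (#(D v) : ℤ)) * ((∏ w ∈ R, ((#(D w) : ℤ) - #W)) *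
          ((#W : ℤ) ^ #(W \ R) - #(W \ R) * (#W : ℤ) ^ (#(W \ R) - 1))) := by
    intro R hR
    rw [mem_powerset] at hR
    rcases R.eq_empty_or_nonempty with rfl | hR0
    · -- Without roots no orbit leaves `W`.
      have h0 : #{p ∈ {p ∈ Fintype.piFinset D | ∀ v, ∃ k, p^[k] v ∉ W} |
          {w ∈ W | p w ∉ W} = ∅} = 0 := by
        rw [card_eq_zero, filter_eq_empty_iff]
        intro p hp h
        obtain ⟨w, hw⟩ := hW
        obtain ⟨k, hk⟩ := (mem_filter.1 hp).2 w
        refine hk ?_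
        clear hk
        induction k with
        | zero => exact hw
        | succ k ihk =>
          rw [Function.iterate_succ_apply']
          by_contra h'
          exact (filter_eq_empty_iff.1 h) ihk h'
      rw [h0]
      have : #W ≠ 0 := by rw [Ne, card_eq_zero]; exact hW.ne_empty
      obtain ⟨m, hm⟩ := Nat.exists_eq_succ_of_ne_zero this
      simp [hm, pow_succ']
    · set D' : V → Finset V := fun v => if v ∈ R then D v \ W else if v ∈ W then W else D v
        with hD'
      have hset : {p ∈ {p ∈ Fintype.piFinset D | ∀ v, ∃ k, p^[k] v ∉ W} |
          {w ∈ W | p w ∉ W} = R} =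
          {p ∈ Fintype.piFinset D' | ∀ v, ∃ k, p^[k] v ∉ W \ R} := by
        ext p
        simp only [mem_filter, Fintype.mem_piFinset]
        constructor
        · rintro ⟨⟨h1, h2⟩, rfl⟩
          refine ⟨fun v => ?_, fun v => ?_⟩
          · have := h1 v
            simp only [hD', mem_filter]
            split_ifs <;> simp_all
          · obtain ⟨k, hk⟩ := h2 v
            exact ⟨k, fun h => hk (mem_sdiff.1 h).1⟩
        · rintro ⟨h1, h2⟩
          have hpR : ∀ v ∈ R, p v ∈ D v ∧ p v ∉ W := by
            intro v hv
            have := h1 v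
            simpa [hD', hv] using this
          have hpW : ∀ v ∈ W, v ∉ R → p v ∈ W := by
            intro v hv hv'
            have := h1 v
            simpa [hD', hv, hv'] using this
          refine ⟨⟨fun v => ?_, fun v => ?_⟩, ?_⟩
          · by_cases hvR : v ∈ R
            · exact (hpR v hvR).1
            · by_cases hvW : v ∈ W
              · exact hD v hvW (hpW v hvW hvR)
              · have := h1 v
                simpa [hD', hvR, hvW] using this
          · obtain ⟨k, hk⟩ := h2 v
            by_cases hvW : p^[k] v ∈ W
            · have hvR : p^[k] v ∈ R := by
                by_contra h
                exact hk (mem_sdiff.2 ⟨hvW, h⟩)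
              exact ⟨k + 1, by rw [Function.iterate_succ_apply']; exact (hpR _ hvR).2⟩
            · exact ⟨k, hvW⟩
          · ext v
            simp only [mem_filter]
            constructor
            · rintro ⟨h, h'⟩
              by_contra hv
              exact h' (hpW v h hv)
            · exact fun h => ⟨hR h, (hpR v h).2⟩
      have hWR : ∀ w ∈ W \ R, D' w = W := by
        intro w hw
        rw [mem_sdiff] at hw
        simp [hD', hw.1, hw.2]
      rw [hset, ih (W \ R) (sdiff_ssubset hR hR0) D'
        (fun w hw => by rw [hWR w hw]; exact sdiff_subset)]
      have hcompl : (W \ R)ᶜ = Wᶜ ∪ R := by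
        ext v; simp only [mem_compl, mem_sdiff, mem_union]; tauto
      have hdisj : Disjoint Wᶜ R := by
        rw [disjoint_left]
        exact fun v hv hv' => (mem_compl.1 hv) (hR hv')
      rw [hcompl, prod_union hdisj, mul_assoc]
      congr 1
      · refine prod_congr rfl fun v hv => ?_
        rw [mem_compl] at hv
        have hvR : v ∉ R := fun h => hv (hR h)
        simp [hD', hv, hvR]
      · congr 1
        · refine prod_congr rfl fun v hv => ?_
          simp only [hD', if_pos hv]
          rw [cast_card_sdiff (hD v (hR hv))]
        · rw [prod_congr rfl fun w hw => by rw [hWR w hw], prod_const]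
          congr 1
          rw [sum_congr rfl fun a ha => ?_, sum_const, nsmul_eq_mul]
          rw [prod_congr rfl fun w hw => by rw [hWR w (mem_of_mem_erase hw)], prod_const,
            card_erase_of_mem ha]
  rw [card_eq_sum_card_fiberwise hmaps, Nat.cast_sum, sum_congr rfl hfib, ← mul_sum,
    sum_powerset_prod_mul]
  simp only [sub_add_cancel]

/-! ### Rooted trees as parent maps -/

section ParentMap

variable {V : Type*}

/-- The maps that send every vertex other than the root `ρ` to its parent in some tree. The root is
encoded as its own parent. -/
def IsParentMap (ρ : V) (p : V → V) : Prop :=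
  p ρ = ρ ∧ ∀ v, ∃ k, p^[k] v = ρ

/-- The tree with parent map `p`. -/
def parentGraph (p : V → V) : SimpleGraph V :=
  SimpleGraph.fromRel fun v w => p v = w

theorem parentGraph_adj {p : V → V} {v w : V} :
    (parentGraph p).Adj v w ↔ v ≠ w ∧ (p v = w ∨ p w = v) := by
  simp [parentGraph]

namespace IsParentMap

variable {ρ : V} {p q : V → V}

open Classical in
/-- The depth function of the tree. -/
theorem exists_depth (hp : IsParentMap ρ p) :
    ∃ d : V → ℕ, ∀ v, v ≠ ρ → d v = d (p v) + 1 := by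
  refine ⟨fun v => Nat.find (hp.2 v), fun v hv => ?_⟩
  rw [Nat.find_eq_iff]
  refine ⟨?_, fun m hm => ?_⟩
  · rw [Function.iterate_succ_apply]
    exact Nat.find_spec (hp.2 (p v))
  · cases m with
    | zero => simpa using hv
    | succ m =>
      rw [Function.iterate_succ_apply]
      exact Nat.find_min (hp.2 (p v)) (Nat.lt_of_succ_lt_succ hm)

theorem apply_ne (hp : IsParentMap ρ p) {v : V} (hv : v ≠ ρ) : p v ≠ v := by
  obtain ⟨d, hd⟩ := hp.exists_depth
  intro h
  have := hd v hv
  rw [h] at this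
  omega

theorem isTree [Finite V] (hp : IsParentMap ρ p) : (parentGraph p).IsTree := by
  classical
  obtain ⟨d, hd⟩ := hp.exists_depth
  have hadj : ∀ v, v ≠ ρ → (parentGraph p).Adj v (p v) := fun v hv =>
    parentGraph_adj.2 ⟨(hp.apply_ne hv).symm, Or.inl rfl⟩
  have hreach : ∀ k v, p^[k] v = ρ → (parentGraph p).Reachable v ρ := by
    intro k
    induction k with
    | zero => intro v hv; rw [Function.iterate_zero_apply] at hv; rw [hv]
    | succ k ih =>
      intro v hv
      by_cases hvρ : v = ρ
      · rw [hvρ]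
      · exact (hadj v hvρ).reachable.trans (ih _ (by rwa [Function.iterate_succ_apply] at hv))
  have hroot : ∀ v, (parentGraph p).Reachable v ρ := fun v => by
    obtain ⟨k, hk⟩ := hp.2 v
    exact hreach k v hk
  rw [SimpleGraph.isTree_iff_connected_and_card]
  have : Nonempty V := ⟨ρ⟩
  refine ⟨⟨fun v w => (hroot v).trans (hroot w).symm⟩, ?_⟩
  -- The edges correspond to the vertices other than the root.
  let f : {v // v ≠ ρ} → (parentGraph p).edgeSet := fun v => ⟨s(v.1, p v.1), hadj v.1 v.2⟩
  have hf : Function.Bijective f := by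
    constructor
    · rintro ⟨v, hv⟩ ⟨w, hw⟩ h
      have h' : s(v, p v) = s(w, p w) := congrArg Subtype.val h
      rw [Sym2.eq_iff] at h'
      rcases h' with ⟨h1, -⟩ | ⟨h1, h2⟩
      · exact Subtype.ext h1
      · have e1 := hd v hv
        have e2 := hd w hw
        rw [h2] at e1
        rw [← h1] at e2
        omega
    · rintro ⟨e, he⟩
      induction e using Sym2.ind with
      | _ v w =>
      obtain ⟨hne, h | h⟩ := parentGraph_adj.1 he
      · have hv : v ≠ ρ := by rintro rfl; exact hne (hp.1.symm.trans h)
        exact ⟨⟨v, hv⟩, Subtype.ext (by simp [f, h])⟩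
      · have hw : w ≠ ρ := by rintro rfl; exact hne (h.symm.trans hp.1)
        exact ⟨⟨w, hw⟩, Subtype.ext (by simp [f, h, Sym2.eq_swap])⟩
  rw [← Nat.card_congr (Equiv.ofBijective f hf)]
  have := Fintype.ofFinite V
  rw [Nat.card_eq_fintype_card, Nat.card_eq_fintype_card, Fintype.card_subtype_compl]
  have : 0 < Fintype.card V := Fintype.card_pos
  simp; omega

theorem eq_of_parentGraph_eq (hp : IsParentMap ρ p) (hq : IsParentMap ρ q)
    (h : parentGraph p = parentGraph q) : p = q := by
  obtain ⟨d, hd⟩ := hp.exists_depth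
  suffices ∀ n v, d v = n → p v = q v from funext fun v => this _ v rfl
  intro n
  induction n with
  | zero =>
    intro v hv
    by_cases hvρ : v = ρ
    · rw [hvρ, hp.1, hq.1]
    · have := hd v hvρ; omega
  | succ n ih =>
    intro v hv
    by_cases hvρ : v = ρ
    · rw [hvρ, hp.1, hq.1]
    have e := hd v hvρ
    have hadj : (parentGraph q).Adj v (p v) :=
      h ▸ parentGraph_adj.2 ⟨(hp.apply_ne hvρ).symm, Or.inl rfl⟩
    rcases (parentGraph_adj.1 hadj).2 with h1 | h1
    · exact h1.symm
    · -- Otherwise `v` would be the parent of its own parent.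
      rw [← ih (p v) (by omega)] at h1
      exfalso
      by_cases hpρ : p v = ρ
      · rw [hpρ, hp.1] at h1; exact hvρ h1.symm
      · have e' := hd (p v) hpρ
        rw [h1] at e'; omega

end IsParentMap

theorem exists_isParentMap_of_isTree [Finite V] {T : SimpleGraph V} (hT : T.IsTree) (ρ : V) :
    ∃ p, IsParentMap ρ p ∧ parentGraph p = T := by
  classical
  have hconn : T.Connected := hT.connected
  have hex : ∀ v, v ≠ ρ → ∃ w, T.Adj v w ∧ T.dist w ρ + 1 = T.dist v ρ := by
    intro v hv
    obtain ⟨W, hW⟩ := hconn.exists_walk_length_eq_dist v ρ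
    cases W with
    | nil => exact absurd rfl hv
    | @cons _ w _ hadj W' =>
      refine ⟨w, hadj, ?_⟩
      have h1 := SimpleGraph.dist_le W'
      have h2 : T.dist v ρ ≤ T.dist v w + T.dist w ρ := hconn.dist_triangle
      rw [SimpleGraph.dist_eq_one_iff_adj.2 hadj] at h2
      rw [SimpleGraph.Walk.length_cons] at hW
      omega
  choose! f hf using hex
  have hp : IsParentMap ρ (fun v => if v = ρ then ρ else f v) := by
    refine ⟨by simp, ?_⟩
    suffices ∀ n v, T.dist v ρ = n →
        ∃ k, (fun v => if v = ρ then ρ else f v)^[k] v = ρ from fun v => this _ v rfl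
    intro n
    induction n with
    | zero => intro v hv; exact ⟨0, (hconn.dist_eq_zero_iff).1 hv⟩
    | succ n ih =>
      intro v hv
      by_cases hvρ : v = ρ
      · exact ⟨0, hvρ⟩
      · obtain ⟨k, hk⟩ := ih (f v) (by have := (hf v hvρ).2; omega)
        exact ⟨k + 1, by rw [Function.iterate_succ_apply]; simpa [hvρ] using hk⟩
  refine ⟨_, hp, ?_⟩
  have hle : parentGraph (fun v => if v = ρ then ρ else f v) ≤ T := by
    have key : ∀ v w, v ≠ w → (if v = ρ then ρ else f v) = w → T.Adj v w := by
      intro v w hne h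
      split_ifs at h with hv
      · exact absurd (hv.trans h) hne
      · exact h ▸ (hf v hv).1
    intro v w h
    obtain ⟨hne, h | h⟩ := parentGraph_adj.1 h
    · exact key v w hne h
    · exact (key w v hne.symm h).symm
  exact le_antisymm hle
    ((SimpleGraph.isTree_iff_minimal_connected.1 hT).2 hp.isTree.connected hle)

end ParentMap

/-! ### The initial descent of the search -/

section Leg

variable {V : Type*} [LinearOrder V] (p : V → V) (ρ : V)

/-- The list `l` of vertices is the descent from `u` in the tree with parent map `p` and root `ρ`:
each vertex of `u :: l` is followed by its child of highest label, and the last one has no child. -/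
def IsDescent : V → List V → Prop
  | u, [] => ∀ w, w ≠ ρ → p w ≠ u
  | u, v :: l => (v ≠ ρ ∧ p v = u) ∧ (∀ w, w ≠ ρ → p w = u → w ≤ v) ∧ IsDescent v l

variable {p ρ}

theorem IsDescent.depth_lt {d : V → ℕ} (hd : ∀ v, v ≠ ρ → d v = d (p v) + 1) {u : V} {l : List V}
    (h : IsDescent p ρ u l) : ∀ w ∈ l, d u < d w := by
  induction l generalizing u with
  | nil => simp
  | cons v l ih =>
    obtain ⟨⟨hv, rfl⟩, -, h⟩ := h
    have := hd v hv
    intro w hw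
    rcases List.mem_cons.1 hw with rfl | hw
    · omega
    · have := ih h w hw; omega

theorem IsDescent.nodup (hp : IsParentMap ρ p) {u : V} {l : List V} (h : IsDescent p ρ u l) :
    (u :: l).Nodup := by
  obtain ⟨d, hd⟩ := hp.exists_depth
  induction l generalizing u with
  | nil => simp
  | cons v l ih =>
    exact List.nodup_cons.2 ⟨fun hu => lt_irrefl _ (h.depth_lt hd u hu), ih h.2.2⟩

theorem IsDescent.eq {u : V} {l l' : List V} (h : IsDescent p ρ u l) (h' : IsDescent p ρ u l') :
    l = l' := by
  induction l generalizing u l' with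
  | nil =>
    cases l' with
    | nil => rfl
    | cons v l' => exact absurd h'.1.2 (h v h'.1.1)
  | cons v l ih =>
    cases l' with
    | nil => exact absurd h.1.2 (h' v h.1.1)
    | cons v' l' =>
      have hvv : v = v' :=
        le_antisymm (h'.2.1 v h.1.1 h.1.2) (h.2.1 v' h'.1.1 h'.1.2)
      subst hvv
      rw [ih h.2.2 h'.2.2]

theorem IsDescent.iterate {u : V} {l : List V} (h : IsDescent p ρ u l)
    (hu : ∃ k, p^[k] u = ρ) : ∀ w ∈ l, ∃ k, p^[k] w = ρ := by
  induction l generalizing u with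
  | nil => simp
  | cons v l ih =>
    obtain ⟨⟨-, rfl⟩, -, h⟩ := h
    obtain ⟨k, hk⟩ := hu
    have hv : ∃ k, p^[k] v = ρ := ⟨k + 1, by rw [Function.iterate_succ_apply, hk]⟩
    intro w hw
    rcases List.mem_cons.1 hw with rfl | hw
    · exact hv
    · exact ih h hv w hw

variable [Fintype V]

/-- Every descent ends, since the depth increases along it and `V` is finite. -/
theorem exists_isDescent (hp : IsParentMap ρ p) (u : V) : ∃ l, IsDescent p ρ u l := by
  obtain ⟨d, hd⟩ := hp.exists_depth
  have : IsTrans V (fun a b => d b < d a) := ⟨fun _ _ _ h1 h2 => h2.trans h1⟩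
  have : Std.Irrefl (fun a b : V => d b < d a) := ⟨fun _ => lt_irrefl _⟩
  induction u using (Finite.wellFounded_of_trans_of_irrefl (fun a b : V => d b < d a)).induction with
  | _ u ih =>
  by_cases h : ({w | w ≠ ρ ∧ p w = u} : Finset V).Nonempty
  · have hmem := (mem_filter.1 (max'_mem _ h)).2
    obtain ⟨l, hl⟩ := ih (max' _ h) (by
      have := hd _ hmem.1
      rw [hmem.2] at this
      omega)
    exact ⟨_ :: l, hmem, fun w hw hwu => le_max' _ _ (by simp [hw, hwu]), hl⟩
  · exact ⟨[], fun w hw hwu => h ⟨w, by simp [hw, hwu]⟩⟩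

/-- During the descent, the unvisited neighbors of the current vertex are its children: the other
neighbor, its parent, is visited, and no visited vertex is deeper than the current one. -/
theorem unvisitedNeighbors_parentGraph [DecidableRel (parentGraph p).Adj] (hp : IsParentMap ρ p)
    {d : V → ℕ} (hd : ∀ v, v ≠ ρ → d v = d (p v) + 1) {u : V} {S : Finset V} (hS : p u ∈ S)
    (hdS : ∀ w ∈ S, d w ≤ d u) :
    unvisitedNeighbors (parentGraph p) S u = ({w | w ≠ ρ ∧ p w = u} : Finset V) := by
  ext w
  simp only [unvisitedNeighbors, mem_filter, mem_univ, true_and, parentGraph_adj]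
  constructor
  · rintro ⟨⟨hne, h | h⟩, hw⟩
    · exact absurd (h ▸ hS) hw
    · exact ⟨by rintro rfl; exact hne (h.symm.trans hp.1), h⟩
  · rintro ⟨hw, rfl⟩
    refine ⟨⟨hp.apply_ne hw, Or.inr rfl⟩, fun h => ?_⟩
    have := hdS w h
    have := hd w hw
    omega

/-- The search follows the descent `l` until it first backtracks or has made `k` moves. The
hypotheses on the set `S` of visited vertices are preserved when the search visits a child. -/
theorem length_takeWhile_moves [DecidableRel (parentGraph p).Adj] (hp : IsParentMap ρ p)
    {d : V → ℕ} (hd : ∀ v, v ≠ ρ → d v = d (p v) + 1) {u : V} {l : List V}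
    (h : IsDescent p ρ u l) (k : ℕ) (rest : List V) {S : Finset V} (huS : u ∈ S) (hS : p u ∈ S)
    (hdS : ∀ w ∈ S, d w ≤ d u) :
    ((moves (parentGraph p) k ⟨u :: rest, S⟩).takeWhile Move.isVisit).length =
      min k l.length := by
  induction l generalizing u k rest S with
  | nil =>
    cases k with
    | zero => simp [moves]
    | succ k =>
      have : ¬ (unvisitedNeighbors (parentGraph p) S u).Nonempty := by
        rw [unvisitedNeighbors_parentGraph hp hd hS hdS]
        rintro ⟨w, hw⟩
        have := (mem_filter.1 hw).2
        exact h w this.1 this.2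
      simp [moves, step, this, Move.isVisit]
  | cons v l ih =>
    cases k with
    | zero => simp [moves]
    | succ k =>
      obtain ⟨hv, hmax, hl⟩ := h
      have hne : (unvisitedNeighbors (parentGraph p) S u).Nonempty := by
        rw [unvisitedNeighbors_parentGraph hp hd hS hdS]
        exact ⟨v, by simp [hv.1, hv.2]⟩
      have hm : (unvisitedNeighbors (parentGraph p) S u).max' hne = v := by
        rw [max'_eq_iff, unvisitedNeighbors_parentGraph hp hd hS hdS]
        refine ⟨by simp [hv.1, hv.2], fun b hb => ?_⟩
        have := (mem_filter.1 hb).2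
        exact hmax b this.1 this.2
      have hdv := hd v hv.1
      rw [hv.2] at hdv
      have := ih hl k (u :: rest) (S := insert v S) (mem_insert_self _ _)
        (mem_insert_of_mem (hv.2 ▸ huS)) (by
          intro w hw
          rcases mem_insert.1 hw with rfl | hw
          · exact le_rfl
          · have := hdS w hw; omega)
      simp only [moves, step, hne, dif_pos, hm]
      rw [List.takeWhile_cons_of_pos (by rfl), List.length_cons, this, List.length_cons]
      omega

theorem leg_parentGraph [DecidableRel (parentGraph p).Adj] (hp : IsParentMap ρ p) {l : List V}
    (h : IsDescent p ρ ρ l) : leg (parentGraph p) ρ = l.length := by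
  obtain ⟨d, hd⟩ := hp.exists_depth
  -- The bound `2 * |V|` on the number of moves does not cut the descent short.
  rw [leg, dfs, length_takeWhile_moves hp hd h _ _ (by simp) (by simp [hp.1]) (by simp)]
  have := (List.nodup_cons.1 (h.nodup hp)).2.length_le_card
  omega

end Leg

/-! ### Counting the trees with a given descent -/

section Compatible

variable {V : Type*} [LinearOrder V]

/-- The vertex `x` is permitted as the parent of the vertex `w` if the list `l` is to be the descent
from `u`. -/
def Compatible : V → List V → V → V → Prop
  | u, [], _, x => x ≠ u
  | u, v :: l, w, x => (w = v → x = u) ∧ (x = u → w ≤ v) ∧ Compatible v l w x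

/-- Being a descent is a conjunction of conditions on the single values of the parent map. -/
theorem isDescent_iff {p : V → V} {ρ u : V} {l : List V} (hl : ∀ v ∈ l, v ≠ ρ) :
    IsDescent p ρ u l ↔ ∀ w, w ≠ ρ → Compatible u l w (p w) := by
  induction l generalizing u with
  | nil => rfl
  | cons v l ih =>
    rw [IsDescent, ih fun w hw => hl w (List.mem_cons_of_mem _ hw)]
    have hv := hl v List.mem_cons_self
    constructor
    · rintro ⟨⟨-, h1⟩, h2, h3⟩ w hw
      exact ⟨by rintro rfl; exact h1, h2 w hw, h3 w hw⟩
    · intro h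
      exact ⟨⟨hv, (h v hv).1 rfl⟩, fun w hw => (h w hw).2.1, fun w hw => (h w hw).2.2⟩

theorem compatible_of_notMem {u w x : V} {l : List V} (hx : x ∉ u :: l) (hw : w ∉ l) :
    Compatible u l w x := by
  induction l generalizing u with
  | nil => simpa [Compatible] using hx
  | cons v l ih =>
    rw [List.mem_cons, not_or] at hx hw
    exact ⟨fun h => absurd h hw.1, fun h => absurd h hx.1, ih hx.2 hw.2⟩

/-- On the descent, the only permitted parent is the predecessor. -/
theorem exists_compatible_iff_eq {u w : V} {l : List V} (hl : (u :: l).Nodup) (hw : w ∈ l) :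
    ∃ a ∈ u :: l, ∀ x, Compatible u l w x ↔ x = a := by
  induction l generalizing u with
  | nil => simp at hw
  | cons v l ih =>
    obtain ⟨hu, hvl⟩ := List.nodup_cons.1 hl
    by_cases hwv : w = v
    · subst hwv
      refine ⟨u, List.mem_cons_self, fun x => ⟨fun h => h.1 rfl, ?_⟩⟩
      rintro rfl
      exact ⟨fun _ => rfl, fun _ => le_rfl,
        compatible_of_notMem hu (List.nodup_cons.1 hvl).1⟩
    · obtain ⟨a, ha, h⟩ := ih hvl ((List.mem_cons.1 hw).resolve_left hwv)
      refine ⟨a, List.mem_cons_of_mem _ ha, fun x => ?_⟩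
      rw [Compatible, h]
      refine ⟨fun h => h.2.2, ?_⟩
      rintro rfl
      exact ⟨fun h => absurd h hwv, fun h => absurd (h ▸ ha) hu, rfl⟩

open scoped Classical in
/-- A vertex outside the descent may be attached to every vertex outside the descent, and to the
predecessor of `s` for every `s ∈ l` with `w < s`. -/
theorem card_compatible {u w : V} {l : List V} (hl : (u :: l).Nodup) (hw : w ∉ l) (B : Finset V)
    (hB : ∀ v ∈ u :: l, v ∈ B) :
    #{x ∈ B | Compatible u l w x} = #(B \ (u :: l).toFinset) + #{s ∈ l.toFinset | w < s} := by
  induction l generalizing u B with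
  | nil =>
    rw [List.toFinset_nil, filter_empty, card_empty, add_zero]
    congr 1
    ext x
    rw [mem_filter, mem_sdiff, Compatible]
    simp
  | cons v l ih =>
    obtain ⟨hu, hvl⟩ := List.nodup_cons.1 hl
    rw [List.mem_cons, not_or] at hw
    have h1 := ih hvl hw.2 (B.erase u) fun x hx => mem_erase.2
      ⟨by rintro rfl; exact hu hx, hB x (List.mem_cons_of_mem _ hx)⟩
    have h2 : B.erase u \ (v :: l).toFinset = B \ (u :: v :: l).toFinset := by
      ext x; simp; tauto
    rw [h2] at h1
    have huB := hB u List.mem_cons_self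
    have hvl' : v ∉ l.toFinset := by simpa using (List.nodup_cons.1 hvl).1
    have hcu : Compatible v l w u := compatible_of_notMem hu hw.2
    rw [List.toFinset_cons (l := l), filter_insert]
    by_cases hwv : w < v
    · have h3 : ({x ∈ B | Compatible u (v :: l) w x} : Finset V) =
          insert u {x ∈ B.erase u | Compatible v l w x} := by
        ext x
        rw [mem_insert, mem_filter, mem_filter, mem_erase, Compatible]
        constructor
        · rintro ⟨h, -, -, h'⟩
          by_cases hx : x = u
          · exact Or.inl hx
          · exact Or.inr ⟨⟨hx, h⟩, h'⟩
        · rintro (rfl | ⟨⟨hx, h⟩, h'⟩)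
          · exact ⟨huB, fun h => absurd h hw.1, fun _ => hwv.le, hcu⟩
          · exact ⟨h, fun h => absurd h hw.1, fun h => absurd h hx, h'⟩
      rw [h3, card_insert_of_notMem (by simp), h1, if_pos hwv, card_insert_of_notMem (by simp [hvl'])]
      simp only [List.toFinset_cons]
      ring
    · have h3 : ({x ∈ B | Compatible u (v :: l) w x} : Finset V) =
          {x ∈ B.erase u | Compatible v l w x} := by
        ext x
        rw [mem_filter, mem_filter, mem_erase, Compatible]
        constructor
        · rintro ⟨h, -, hx, h'⟩
          exact ⟨⟨fun e => hwv (lt_of_le_of_ne (hx e) hw.1), h⟩, h'⟩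
        · rintro ⟨⟨hx, h⟩, h'⟩
          exact ⟨h, fun h => absurd h hw.1, fun h => absurd h hx, h'⟩
      rw [h3, h1, if_neg hwv]

end Compatible

section Count

variable {V : Type*} [Fintype V] [LinearOrder V] {ρ : V}

open scoped Classical in
theorem card_isDescent {l : List V} (hl : (ρ :: l).Nodup) {m : ℕ}
    (hm : Fintype.card V = m + l.length + 1) :
    (#{p : V → V | IsParentMap ρ p ∧ IsDescent p ρ ρ l} : ℤ) =
      ∏ w ∈ univ.erase ρ \ l.toFinset, ((m : ℤ) + #{s ∈ l.toFinset | w < s}) -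
        ∑ a ∈ univ.erase ρ \ l.toFinset, ∏ w ∈ (univ.erase ρ \ l.toFinset).erase a,
          ((m : ℤ) + #{s ∈ l.toFinset | w < s}) := by
  have hρl : ∀ v ∈ l, v ≠ ρ := by
    rintro v hv rfl; exact (List.nodup_cons.1 hl).1 hv
  set W : Finset V := univ.erase ρ \ l.toFinset with hW
  have hmemW : ∀ w, w ∈ W ↔ w ≠ ρ ∧ w ∉ l := fun w => by simp [hW]
  have hW' : W = univ \ (ρ :: l).toFinset := by ext w; simp [hW]
  have hcardW : #W = m := by
    rw [hW', card_sdiff_of_subset (subset_univ _), card_univ, hm, List.toFinset_card_of_nodup hl,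
      List.length_cons]
    omega
  set D : V → Finset V := fun w =>
    if w = ρ then {ρ} else ({x | Compatible ρ l w x} : Finset V) with hD
  have hDW : ∀ w ∈ W, W ⊆ D w := by
    intro w hw x hx
    rw [hmemW] at hw hx
    simp only [hD, hw.1, if_false, mem_filter, mem_univ, true_and]
    exact compatible_of_notMem (by simp [hx.1, hx.2]) hw.2
  have hcardDW : ∀ w ∈ W, (#(D w) : ℤ) = (m : ℤ) + #{s ∈ l.toFinset | w < s} := by
    intro w hw
    rw [hmemW] at hw
    simp only [hD, hw.1, if_false]
    rw [card_compatible hl hw.2 univ (by simp), ← hW', hcardW]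
    push_cast; rfl
  have hcardD : ∀ w ∈ Wᶜ, (#(D w) : ℤ) = 1 := by
    intro w hw
    rw [mem_compl, hmemW] at hw
    by_cases hwρ : w = ρ
    · simp [hD, hwρ]
    · have hwl : w ∈ l := by tauto
      obtain ⟨a, -, ha⟩ := exists_compatible_iff_eq hl hwl
      have : D w = {a} := by
        ext x; simp [hD, hwρ, ha]
      simp [this]
  have hset : ({p : V → V | IsParentMap ρ p ∧ IsDescent p ρ ρ l} : Finset (V → V)) =
      {p ∈ Fintype.piFinset D | ∀ v, ∃ k, p^[k] v ∉ W} := by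
    ext p
    simp only [mem_filter, mem_univ, true_and, Fintype.mem_piFinset]
    constructor
    · rintro ⟨hp, h⟩
      refine ⟨fun w => ?_, fun v => ?_⟩
      · by_cases hwρ : w = ρ
        · simp [hD, hwρ, hp.1]
        · simpa [hD, hwρ] using (isDescent_iff hρl).1 h w hwρ
      · obtain ⟨k, hk⟩ := hp.2 v
        exact ⟨k, by simp [hk, hmemW]⟩
    · rintro ⟨h1, h2⟩
      have hρ : p ρ = ρ := by simpa [hD] using h1 ρ
      have hdesc : IsDescent p ρ ρ l := (isDescent_iff hρl).2 fun w hw => by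
        simpa [hD, hw] using h1 w
      refine ⟨⟨hρ, fun v => ?_⟩, hdesc⟩
      obtain ⟨k, hk⟩ := h2 v
      rw [hmemW] at hk
      by_cases hkρ : p^[k] v = ρ
      · exact ⟨k, hkρ⟩
      · obtain ⟨j, hj⟩ := hdesc.iterate ⟨0, rfl⟩ (p^[k] v) (by tauto)
        exact ⟨j + k, by rw [Function.iterate_add_apply, hj]⟩
  rw [hset, card_escaping W D hDW, prod_congr rfl hcardD, prod_const_one, one_mul,
    prod_congr rfl hcardDW, sum_congr rfl fun a _ => prod_congr rfl fun w hw =>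
      hcardDW w (mem_of_mem_erase hw)]

open scoped Classical in
/-- The descent of length `r` runs through the vertices of an `r`-subset `S` in any of `r!` orders,
and the number of trees with a given descent depends on `S` only. -/
theorem card_exists_isDescent {m r : ℕ} (h : Fintype.card V = m + (r + 1) + 1) :
    (#{p : V → V | IsParentMap ρ p ∧ ∃ l, l.length = r + 1 ∧ IsDescent p ρ ρ l} : ℤ) =
      ((r + 1).factorial : ℤ) * (shiftedComplete (m + r) r).eval (m : ℤ) := by
  have hA : #((univ : Finset V).erase ρ) = m + (r + 1) := by
    rw [card_erase_of_mem (mem_univ _), card_univ, h]; rfl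
  rw [← sum_powersetCard_prod_sub_sum_prod _ hA, mul_sum]
  set P : Finset (V → V) :=
    {p : V → V | IsParentMap ρ p ∧ ∃ l, l.length = r + 1 ∧ IsDescent p ρ ρ l}
    with hP
  -- `f p` is the descent of `p` from the root, with the junk value `[]` if there is none.
  let f : (V → V) → List V := fun p => if h : ∃ l, IsDescent p ρ ρ l then h.choose else []
  have hf : ∀ p l, IsDescent p ρ ρ l → f p = l := by
    intro p l hl
    have hex : ∃ l, IsDescent p ρ ρ l := ⟨l, hl⟩
    simp only [f, dif_pos hex]
    exact hex.choose_spec.eq hl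
  have hmaps : ∀ p ∈ P, (f p).toFinset ∈ (univ.erase ρ).powersetCard (r + 1) := by
    intro p hp
    obtain ⟨hp, l, hlen, hl⟩ := (mem_filter.1 hp).2
    have hnd := List.nodup_cons.1 (hl.nodup hp)
    rw [hf p l hl, mem_powersetCard, List.toFinset_card_of_nodup hnd.2]
    refine ⟨fun v hv => ?_, hlen⟩
    rw [List.mem_toFinset] at hv
    exact mem_erase.2 ⟨by rintro rfl; exact hnd.1 hv, mem_univ _⟩
  rw [card_eq_sum_card_fiberwise hmaps, Nat.cast_sum]
  refine sum_congr rfl fun S hS => ?_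
  obtain ⟨hSρ, hScard⟩ := mem_powersetCard.1 hS
  have hmaps' : ∀ p ∈ {p ∈ P | (f p).toFinset = S}, f p ∈ S.toList.permutations.toFinset := by
    intro p hp
    obtain ⟨hp, hpS⟩ := mem_filter.1 hp
    obtain ⟨hp, l, hlen, hl⟩ := (mem_filter.1 hp).2
    rw [hf p l hl] at hpS ⊢
    rw [List.mem_toFinset, List.mem_permutations,
      List.perm_ext_iff_of_nodup (List.nodup_cons.1 (hl.nodup hp)).2 S.nodup_toList]
    intro v
    rw [mem_toList, ← hpS, List.mem_toFinset]
  have hcard : #S.toList.permutations.toFinset = (r + 1).factorial := by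
    rw [List.toFinset_card_of_nodup (List.nodup_permutations _ S.nodup_toList),
      List.length_permutations, length_toList, hScard]
  rw [card_eq_sum_card_fiberwise hmaps', Nat.cast_sum, ← hcard, ← nsmul_eq_mul, ← sum_const]
  refine sum_congr rfl fun l hl => ?_
  rw [List.mem_toFinset, List.mem_permutations] at hl
  have hlS : l.toFinset = S := by
    ext v; rw [List.mem_toFinset, hl.mem_iff, mem_toList]
  have hlen : l.length = r + 1 := by rw [hl.length_eq, length_toList, hScard]
  have hnd : (ρ :: l).Nodup := List.nodup_cons.2
    ⟨fun hρ => (mem_erase.1 (hSρ (hlS ▸ List.mem_toFinset.2 hρ))).1 rfl,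
      hl.nodup_iff.2 S.nodup_toList⟩
  have hset : {p ∈ {p ∈ P | (f p).toFinset = S} | f p = l} =
      ({p : V → V | IsParentMap ρ p ∧ IsDescent p ρ ρ l} : Finset (V → V)) := by
    ext p
    simp only [hP, mem_filter, mem_univ, true_and]
    constructor
    · rintro ⟨⟨⟨hp, l', -, hl'⟩, -⟩, rfl⟩
      exact ⟨hp, by rwa [hf p l' hl']⟩
    · rintro ⟨hp, hl'⟩
      rw [hf p l hl']
      exact ⟨⟨⟨hp, l, hlen, hl'⟩, hlS⟩, rfl⟩
  rw [hset, card_isDescent hnd (by rw [hlen]; exact h), hlS]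

end Count

open scoped Classical in
/-- Trees are counted through their parent maps, and legs as lengths of descents. -/
theorem coeff_LT (n r : ℕ) :
    (LT n).coeff r = (#{p : Fin (n + 1) → Fin (n + 1) |
      IsParentMap 0 p ∧ ∃ l, l.length = r ∧ IsDescent p 0 0 l} : ℤ) := by
  rw [LT, Polynomial.finsetSum_coeff]
  simp only [Polynomial.coeff_X_pow]
  rw [sum_boole, filter_filter]
  congr 1
  refine (card_bij (fun p _ => parentGraph p) ?_ ?_ ?_).symm
  · intro p hp
    obtain ⟨hp, l, hlen, hl⟩ := (mem_filter.1 hp).2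
    exact mem_filter.2 ⟨mem_univ _, hp.isTree, by rw [leg_parentGraph hp hl, hlen]⟩
  · intro p hp q hq
    exact (mem_filter.1 hp).2.1.eq_of_parentGraph_eq (mem_filter.1 hq).2.1
  · intro T hT
    obtain ⟨hT, hleg⟩ := (mem_filter.1 hT).2
    obtain ⟨p, hp, rfl⟩ := exists_isParentMap_of_isTree hT 0
    obtain ⟨l, hl⟩ := exists_isDescent hp 0
    exact ⟨p, mem_filter.2 ⟨mem_univ _, hp, l, by rw [hleg, leg_parentGraph hp hl], hl⟩, rfl⟩

end DFSLeg

theorem theorem5p1 (n r : ℕ) (hr : 1 ≤ r) (hrn : r ≤ n) :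
    (DFSLeg.LT n).coeff r =
        (r.factorial : ℤ) * ∑ e ∈ Finset.Nat.antidiagonalTuple r (n - r),
          ∏ i : Fin r, ((n : ℤ) - ((i : ℕ) + 1 : ℤ)) ^ e i ∧
    (DFSLeg.LT n).coeff r =
        (r : ℤ) * ∑ j ∈ Finset.range r,
          (-1 : ℤ) ^ j * ((r - 1).choose j : ℤ) * ((n : ℤ) - 1 - (j : ℤ)) ^ (n - 1) := by
  classical
  obtain ⟨r, rfl⟩ := Nat.exists_eq_add_of_le' hr
  obtain ⟨m, rfl⟩ := Nat.exists_eq_add_of_le' hrn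
  have h := DFSLeg.coeff_LT (m + (r + 1)) (r + 1)
  rw [DFSLeg.card_exists_isDescent (m := m) (by simp)] at h
  rw [h]
  refine ⟨?_, ?_⟩
  · rw [DFSLeg.eval_shiftedComplete, DFSLeg.completeSum, Nat.add_sub_cancel]
    congr 1
    refine Finset.sum_congr rfl fun e _ => Finset.prod_congr rfl fun i _ => ?_
    congr 1
    push_cast; ring
  · rw [Nat.factorial_succ, Nat.cast_mul, mul_assoc, DFSLeg.factorial_mul_eval_shiftedComplete]
    congr 1
    refine Finset.sum_congr rfl fun j _ => ?_
    congr 2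
    push_cast; ring
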